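/- Let $K$ be a differential field with field of constants $\mathbb C$ (in particular of characteristic $0$). Let a system of $m$ differential equations $x'=v(x)$ (for instance a Hamiltonian system, $m=2n$) be given along a particular solution $x_0(t)$ by the Taylor expansions $$v_j(x_0+\xi)=\sum_{\alpha\in\mathbb N^m}a_{j,\alpha}\,\xi^\alpha,\qquad a_{j,\alpha}=\tfrac1{\alpha!}(\partial^\alpha v_j)(x_0(t))\in K,\quad 1\le j\le m;$$ more generally, $a_{j,\alpha}$ may be arbitrary elements of $K$. For $p\ge1$ the $p$-th variational equation is obtained by equating the coefficients of $\varepsilon^p$ in $\xi'=v(x_0+\xi)-v(x_0)$ with $\xi=\sum_{s\ge1}\frac{\varepsilon^s}{s!}x_s$; it has the form $x_p'=Ax_p+f_p(x_1,\dots,x_{p-1})$ with $A=\frac{\partial v}{\partial x}(x_0)$, $f_1=0$. Let $\mathrm{VE}_p$ be the system formed by the first $p$ of these equations. Let $L\supset K$ be a differential field extension with the same constants that contains the general solution of all these equations: a fundamental matrix of $x_1'=Ax_1$, and, for every $p\ge1$ and every solution $(x_1,\dots,x_p)$ of $\mathrm{VE}_p$ with components in $L$, a solution $x_{p+1}$ of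 the next equation. Let $\mathrm{PV}(\mathrm{VE}_p)\subset L$ be the differential field generated over $K$ by the components of all solutions $(x_1,\dots,x_p)$ of $\mathrm{VE}_p$ in $L$, and let $\mathrm{Gal}(\mathrm{VE}_p)$ be the group of $K$-automorphisms of the field $\mathrm{PV}(\mathrm{VE}_p)$ that commute with the derivation. For a differential field $F$ with $K\subset F\subset L$, let $T(F/K)$ be the set of elements of $F$ that satisfy a non-trivial linear differential equation with coefficients in $K$. For a tower $K\subset F_1\subset F_2$ of Picard–Vessiot extensions of $K$, an element $\Phi\in F_2$ is an integral of second level if $\Phi'\in T(F_1/K)$. **Lemma 2.1.** Assume that $\mathrm{Gal}(\mathrm{VE}_1)$ is virtually Abelian (it has an Abelian subgroup of finite index). Then for every $p\ge1$: 1. $\mathrm{PV}(\mathrm{VE}_p)\subset\mathrm{PV}(\mathrm{VE}_{p+1})$, and the field $\mathrm{PV}(\mathrm{VE}_{p+1})$ is generated over $\mathrm{PV}(\mathrm{VE}_p)$ by finitely many second level integrals of the tower $K\subset\mathrm{PV}(\mathrm{VE}_p)\subset\mathrm{PV}(\mathrm{VE}_{p+1})$. 2. $\mathrm{PV}(\mathrm{VE}_p)/K$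 is a solvable Picard–Vessiot extension: it has no new constants, it is generated as a field by the entries of a fundamental matrix of a linear differential system with coefficients in $K$, and $\mathrm{Gal}(\mathrm{VE}_p)$ is virtually solvable (it has a solvable subgroup of finite index, i.e. its identity component is solvable). -/

import Mathlib

open scoped Differential Nat

/-! ### Virtually abelian and virtually solvable groups -/

/-- A group is virtually abelian if it has an abelian subgroup of finite index. For a linear
algebraic group this says that its identity component is abelian. -/
def IsVirtuallyAbelian (G : Type*) [Group G] : Prop :=
  ∃ H : Subgroup G, H.FiniteIndex ∧ ∀ x ∈ H, ∀ y ∈ H, x * y = y * x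

/-- A group is virtually solvable if it has a solvable subgroup of finite index. For a linear
algebraic group this says that its identity component is solvable. -/
def IsVirtuallySolvable (G : Type*) [Group G] : Prop :=
  ∃ H : Subgroup G, H.FiniteIndex ∧ Group.IsSolvable H

/-! ### Picard-Vessiot theory -/

/-- The differential Galois group of `F / K`: the `K`-automorphisms of the field `F` that commute
with the derivation. -/
def differentialGal (K F : Type*) [Field K] [Field F] [Differential F] [Algebra K F] :
    Subgroup (F ≃ₐ[K] F) where
  carrier := {σ | ∀ x : F, σ (x′) = (σ x)′}
  mul_mem' := by
    intro σ τ hσ hτ x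
    exact (congrArg σ (hτ x)).trans (hσ (τ x))
  one_mem' := fun _ => rfl
  inv_mem' := by
    intro σ hσ x
    apply σ.injective
    change σ (σ.symm (x′)) = σ ((σ.symm x)′)
    rw [hσ (σ.symm x), σ.apply_symm_apply, σ.apply_symm_apply]

/-- `F / K` is a Picard-Vessiot extension: there are no new constants, and `F` is generated over `K`
by the entries of a fundamental matrix `X` of a linear system `X′ = A X` with coefficients
in `K`. -/
def IsPicardVessiot (K F : Type*) [Field K] [Differential K] [Field F] [Differential F]
    [Algebra K F] [DifferentialAlgebra K F] : Prop :=
  Differential.ContainConstants K F ∧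
    ∃ (n : ℕ) (A : Matrix (Fin n) (Fin n) K) (X : Matrix (Fin n) (Fin n) F),
      IsUnit X.det ∧
      X.map (fun y => y′) = A.map (algebraMap K F) * X ∧
      IntermediateField.adjoin K {y : F | ∃ i j, y = X i j} = ⊤

/-- `y` is holonomic over `K`: it solves a non-trivial linear differential equation
`c₀ y + c₁ y′ + ⋯ + cₙ y⁽ⁿ⁾ = 0` with coefficients in `K`. -/
def IsHolonomic (K : Type*) {L : Type*} [Field K] [Field L] [Differential L] [Algebra K L]
    (y : L) : Prop :=
  ∃ (n : ℕ) (c : Fin (n + 1) → K), c ≠ 0 ∧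
    ∑ i : Fin (n + 1), algebraMap K L (c i) * (fun z : L => z′)^[(i : ℕ)] y = 0

section Tower

variable {K L : Type*} [Field K] [Field L] [Differential L] [Algebra K L]

/-- The Picard-Vessiot ring `T(F / K)`: the elements of `F` that are holonomic over `K`. -/
def picardVessiotRing (F : IntermediateField K L) : Set L :=
  {y | y ∈ F ∧ IsHolonomic K y}

/-- `Φ ∈ F₂` is an integral of second level for the tower `K ⊆ F₁ ⊆ F₂` if
`Φ′ ∈ T(F₁ / K)`. -/
def IsSecondLevelIntegral (F₁ F₂ : IntermediateField K L) (Φ : L) : Prop :=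
  Φ ∈ F₂ ∧ Φ′ ∈ picardVessiotRing F₁

variable (K) in
/-- The differential subfield of `L` generated by a set `S` over `K`. -/
def differentialAdjoin (S : Set L) : IntermediateField K L :=
  sInf {F : IntermediateField K L | (∀ x ∈ F, x′ ∈ F) ∧ S ⊆ F}

theorem deriv_mem_differentialAdjoin (S : Set L) {x : L} (hx : x ∈ differentialAdjoin K S) :
    x′ ∈ differentialAdjoin K S := by
  unfold differentialAdjoin at hx ⊢
  rw [← SetLike.mem_coe, IntermediateField.coe_sInf] at hx ⊢
  simp only [Set.mem_iInter] at hx ⊢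
  exact fun F hF => hF.1 x (hx F hF)

end Tower

/-! ### Variational equations

A system `x′ = v(x)` of `m` equations is given, along a particular solution `x₀`, by the Taylor
expansion `v_j(x₀ + ξ) = ∑_α a_{j,α} ξ^α`, where `a_{j,α} = (∂^α v_j)(x₀(t)) / α!` lies in the
ground field `K`. So the system enters as a tuple of `m` power series in `m` variables
`ξ = (ξ_1, …, ξ_m)` over `K`. -/

section Variational

variable {K : Type*} [Field K] {m : ℕ}

/-- The deviation `ξ_i = ε x_{1,i} + ε² x_{2,i} / 2! + ε³ x_{3,i} / 3! + ⋯` from the particular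
solution, as a formal power series in `ε`. -/
noncomputable def deviation {L : Type*} [Field L] (x : ℕ → Fin m → L) (i : Fin m) :
    PowerSeries L :=
  PowerSeries.mk fun s => if s = 0 then 0 else x s i / (s ! : L)

/-- `(x_1, …, x_p)` solves the variational equations of orders `1, …, p`: the
coefficients of `ε, …, ε^p` agree on both sides of `ξ′ = v(x₀ + ξ) - v(x₀)`, where `ξ` is the
deviation. Only the entries `x 1, …, x p` of the sequence `x` matter. -/
def IsVESolution {L : Type*} [Field L] [Differential L] [Algebra K L]
    (v : Fin m → MvPowerSeries (Fin m) K) (p : ℕ) (x : ℕ → Fin m → L) : Prop :=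
  ∀ q, 1 ≤ q → q ≤ p → ∀ j : Fin m,
    (x q j)′ / (q ! : L) =
      PowerSeries.coeff q (MvPowerSeries.subst (deviation x) (v j) : PowerSeries L)

/-- `L` contains the general solution of the variational equations of every order: a fundamental
matrix of the first (linear homogeneous) one, and, for every solution of the first `q`
equations, a particular solution of the next one (which is linear inhomogeneous, with the same
linear part as the first). -/
def HasGeneralVESolution (L : Type*) [Field L] [Differential L] [Algebra K L]
    (v : Fin m → MvPowerSeries (Fin m) K) : Prop :=
  (∃ X : Matrix (Fin m) (Fin m) L, IsUnit X.det ∧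
      ∀ k, IsVESolution v 1 (fun _ i => X i k)) ∧
    ∀ q, 1 ≤ q → ∀ x : ℕ → Fin m → L, IsVESolution v q x →
      ∃ z : ℕ → Fin m → L, IsVESolution v (q + 1) z ∧ ∀ s, 1 ≤ s → s ≤ q → z s = x s

/-- `PV(VE_p)`, inside a differential field `L` that contains the general solution and has no new
constants: the differential field generated over `K` by the components of all solutions
`(x_1, …, x_p)` of the variational equations of orders `1, …, p`. -/
def PVofVE (L : Type*) [Field L] [Differential L] [Algebra K L]
    (v : Fin m → MvPowerSeries (Fin m) K) (p : ℕ) : IntermediateField K L :=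
  differentialAdjoin K {y : L | ∃ x : ℕ → Fin m → L, IsVESolution v p x ∧
    ∃ q, 1 ≤ q ∧ q ≤ p ∧ ∃ i, y = x q i}

variable (L : Type*) [Field L] [Differential L] [Algebra K L]
  (v : Fin m → MvPowerSeries (Fin m) K) (p : ℕ)

/-- `PV(VE_p)` with the derivation of `L`. -/
noncomputable instance : Differential (PVofVE L v p) where
  deriv := Derivation.mk'
    { toFun := fun x => ⟨(x : L)′, deriv_mem_differentialAdjoin _ x.2⟩
      map_add' := fun x y => Subtype.ext (by simp)
      map_smul' := fun n x => Subtype.ext (by simp) }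
    (fun x y => Subtype.ext (by simp))

theorem PVofVE_coe_deriv (x : PVofVE L v p) : ((x′ : PVofVE L v p) : L) = (x : L)′ := rfl

instance [Differential K] [DifferentialAlgebra K L] :
    DifferentialAlgebra K (PVofVE L v p) where
  deriv_algebraMap a := Subtype.ext (deriv_algebraMap (B := L) a)

end Variational

/-! ### Coefficients of substituted power series -/

section Substitution

/-! Give $x_s$ the weight $s$. The coefficient of $\varepsilon^q$ in $v_j(x_0+\xi)$ is a polynomial
in the components of the $x_s$, weighted homogeneous of weight $q$. By Leibniz, along solutions the
derivative of a monomial is then a polynomial of the same weight, so the finitely many monomials of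
weight at most $p$ satisfy a linear system over $K$ (`exists_linearization`). There are infinitely
many constants, and solutions of the linear part may be added at each order, so the solutions are
Zariski dense; hence finitely many of them give an invertible matrix of monomials
(`exists_fundamentalFamily`). This is the fundamental matrix that makes $\mathrm{PV}(\mathrm{VE}_p)$
Picard–Vessiot.

For a fundamental matrix $X$ of $\mathrm{VE}_1$, variation of constants gives
$(X^{-1}x_{p+1})'=X^{-1}f_{p+1}$. The entries of $X^{-1}$ solve the dual system and $f_{p+1}$ is a
polynomial in lower components, so the right side is holonomic: the entries of $X^{-1}x_{p+1}$ are
second level integrals, and they generate the next field.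

An automorphism trivial on $\mathrm{PV}(\mathrm{VE}_p)$ translates each such integral by a constant,
so the kernel of restriction between successive Galois groups is abelian
(`differentialGalRestrict_ker_comm`). Virtual solvability follows by induction from the virtually
abelian $\mathrm{Gal}(\mathrm{VE}_1)$. -/

theorem PowerSeries.coeff_mvSubst {R S : Type*} [CommRing R] [CommRing S] [Algebra R S] {m : ℕ}
    {a : Fin m → PowerSeries S} (ha : ∀ i, PowerSeries.constantCoeff (a i) = 0)
    (f : MvPowerSeries (Fin m) R) (q : ℕ) :
    PowerSeries.coeff q (MvPowerSeries.subst a f : PowerSeries S) =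
      ∑ᶠ d : Fin m →₀ ℕ, MvPowerSeries.coeff d f •
        PowerSeries.coeff q (d.prod fun s e => a s ^ e) :=
  MvPowerSeries.coeff_subst (MvPowerSeries.hasSubst_of_constantCoeff_zero ha) f _

theorem PowerSeries.coeff_mvSubst_finite {R S : Type*} [CommRing R] [CommRing S] [Algebra R S]
    {m : ℕ} {a : Fin m → PowerSeries S} (ha : ∀ i, PowerSeries.constantCoeff (a i) = 0)
    (f : MvPowerSeries (Fin m) R) (q : ℕ) :
    (fun d : Fin m →₀ ℕ => MvPowerSeries.coeff d f •
        PowerSeries.coeff q (d.prod fun s e => a s ^ e)).HasFiniteSupport :=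
  MvPowerSeries.coeff_subst_finite (MvPowerSeries.hasSubst_of_constantCoeff_zero ha) f _

/-- Substitution commutes with a change of coefficients along an algebra homomorphism. -/
theorem PowerSeries.coeff_mvSubst_map {R S T : Type*} [CommRing R] [CommRing S] [CommRing T]
    [Algebra R S] [Algebra R T] (g : S →ₐ[R] T) {m : ℕ}
    {a : Fin m → PowerSeries S} (ha : ∀ i, PowerSeries.constantCoeff (a i) = 0)
    (f : MvPowerSeries (Fin m) R) (q : ℕ) :
    PowerSeries.coeff q (MvPowerSeries.subst
        (fun i => PowerSeries.map (g : S →+* T) (a i)) f : PowerSeries T) =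
      g (PowerSeries.coeff q (MvPowerSeries.subst a f : PowerSeries S)) := by
  have ha' : ∀ i, PowerSeries.constantCoeff (PowerSeries.map (g : S →+* T) (a i)) = 0 := by
    intro i
    rw [← PowerSeries.coeff_zero_eq_constantCoeff_apply, PowerSeries.coeff_map,
      PowerSeries.coeff_zero_eq_constantCoeff_apply, ha i, map_zero]
  rw [coeff_mvSubst ha', coeff_mvSubst ha]
  have h := AddMonoidHom.map_finsum (g : S →+ T) (coeff_mvSubst_finite ha f q)
  simp only [AddMonoidHom.coe_coe] at h
  rw [h]
  refine finsum_congr fun d => ?_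
  rw [map_smul]
  congr 1
  have : (d.prod fun s e => PowerSeries.map (g : S →+* T) (a s) ^ e) =
      PowerSeries.map (g : S →+* T) (d.prod fun s e => a s ^ e) := by
    simp [Finsupp.prod, map_prod]
  rw [this, PowerSeries.coeff_map]
  rfl

theorem Finsupp.prod_sub_prod_dvd {R : Type*} [CommRing R] {m : ℕ} {r : R} {a b : Fin m → R}
    (h : ∀ i, r ∣ a i - b i) (d : Fin m →₀ ℕ) :
    r ∣ (d.prod fun s e => a s ^ e) - d.prod fun s e => b s ^ e := by
  rw [← Ideal.mem_span_singleton, ← Ideal.Quotient.eq]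
  simp only [Finsupp.prod, map_prod, map_pow]
  refine Finset.prod_congr rfl fun i _ => ?_
  congr 1
  rw [Ideal.Quotient.eq, Ideal.mem_span_singleton]
  exact h i

/-- Changing a factor from degree `q` on changes a product in degree `q` only if no other factor of
positive order is present; so only linear monomials contribute. -/
theorem PowerSeries.coeff_prod_sub_prod {R : Type*} [CommRing R] {m q : ℕ}
    {a b : Fin m → PowerSeries R}
    (ha : ∀ i, PowerSeries.constantCoeff (a i) = 0)
    (hb : ∀ i, PowerSeries.constantCoeff (b i) = 0)
    (h : ∀ i, ∀ n < q, PowerSeries.coeff n (a i) = PowerSeries.coeff n (b i))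
    (d : Fin m →₀ ℕ) :
    PowerSeries.coeff q (d.prod fun s e => a s ^ e) -
      PowerSeries.coeff q (d.prod fun s e => b s ^ e) =
      ∑ k, if d = Finsupp.single k 1 then
        PowerSeries.coeff q (a k) - PowerSeries.coeff q (b k) else 0 := by
  have hdvd : ∀ i, (PowerSeries.X : PowerSeries R) ^ q ∣ a i - b i := fun i => by
    rw [PowerSeries.X_pow_dvd_iff]
    intro n hn
    rw [map_sub, h i n hn, sub_self]
  rcases eq_or_ne d 0 with rfl | hd
  · simp [Finsupp.prod_zero_index, eq_comm (a := (0 : Fin m →₀ ℕ))]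
  obtain ⟨k, hk⟩ := Finsupp.support_nonempty_iff.2 hd
  obtain ⟨e, rfl⟩ : ∃ e, d = Finsupp.single k 1 + e := by
    refine ⟨d - Finsupp.single k 1, ?_⟩
    rw [add_tsub_cancel_of_le]
    rw [Finsupp.single_le_iff]
    exact Nat.one_le_iff_ne_zero.2 (Finsupp.mem_support_iff.1 hk)
  have hprod : ∀ c : Fin m → PowerSeries R,
      ((Finsupp.single k 1 + e).prod fun s e => c s ^ e) = c k * e.prod fun s e => c s ^ e := by
    intro c
    rw [Finsupp.prod_add_index' (by simp) (by simp [pow_add]), Finsupp.prod_single_index (by simp),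
      pow_one]
  rw [hprod, hprod]
  rcases eq_or_ne e 0 with rfl | he
  · rw [Finset.sum_eq_single k]
    · simp
    · intro j _ hj
      rw [if_neg]
      simpa [Finsupp.single_left_inj] using hj.symm
    · simp
  · rw [Finset.sum_eq_zero]
    · obtain ⟨l, hl⟩ := Finsupp.support_nonempty_iff.2 he
      have hX : ∀ c : Fin m → PowerSeries R, (∀ i, PowerSeries.constantCoeff (c i) = 0) →
          ∀ j, (PowerSeries.X : PowerSeries R) ∣ c j := fun c hc j =>
        PowerSeries.X_dvd_iff.2 (hc j)
      have h1 : (PowerSeries.X : PowerSeries R) ∣ e.prod fun s e => a s ^ e :=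
        ((hX a ha l).trans (dvd_pow_self _ (Finsupp.mem_support_iff.1 hl))).trans
          (Finset.dvd_prod_of_mem (fun s => a s ^ e s) hl)
      -- The remaining factor `e` is nontrivial, so it supplies one more power of `X` beyond the `X
      -- ^ q` from the agreement.
      have h2 : (PowerSeries.X : PowerSeries R) ^ (q + 1) ∣
          a k * (e.prod fun s e => a s ^ e) - b k * e.prod fun s e => b s ^ e := by
        have : a k * (e.prod fun s e => a s ^ e) - b k * (e.prod fun s e => b s ^ e) =
          (a k - b k) * (e.prod fun s e => a s ^ e) +
          ((e.prod fun s e => a s ^ e) - e.prod fun s e => b s ^ e) * b k := by ring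
        rw [this, pow_succ]
        exact dvd_add (mul_dvd_mul (hdvd k) h1)
          (mul_dvd_mul (Finsupp.prod_sub_prod_dvd hdvd e) (hX b hb k))
      rw [← map_sub]
      exact PowerSeries.X_pow_dvd_iff.1 h2 q (Nat.lt_succ_self q)
    · intro j _
      rw [if_neg]
      intro hj
      have := congrArg Finsupp.degree hj
      simp only [map_add, Finsupp.degree_single] at this
      exact he ((Finsupp.degree_eq_zero_iff e).1 (by omega))

/-- If two families of power series agree below degree `q`, then the coefficients of degree `q` of
the results of substitution differ by the linear part. -/
theorem PowerSeries.coeff_mvSubst_sub {R S : Type*} [CommRing R] [CommRing S] [Algebra R S]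
    {m q : ℕ} {a b : Fin m → PowerSeries S}
    (ha : ∀ i, PowerSeries.constantCoeff (a i) = 0)
    (hb : ∀ i, PowerSeries.constantCoeff (b i) = 0)
    (h : ∀ i, ∀ n < q, PowerSeries.coeff n (a i) = PowerSeries.coeff n (b i))
    (f : MvPowerSeries (Fin m) R) :
    PowerSeries.coeff q (MvPowerSeries.subst a f : PowerSeries S) -
      PowerSeries.coeff q (MvPowerSeries.subst b f : PowerSeries S) =
      ∑ k, MvPowerSeries.coeff (Finsupp.single k 1) f •
        (PowerSeries.coeff q (a k) - PowerSeries.coeff q (b k)) := by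
  rw [coeff_mvSubst ha, coeff_mvSubst hb,
    ← finsum_sub_distrib (coeff_mvSubst_finite ha f q) (coeff_mvSubst_finite hb f q)]
  simp only [← smul_sub, coeff_prod_sub_prod ha hb h]
  simp only [Finset.smul_sum, smul_ite, smul_zero]
  rw [finsum_sum_comm]
  · refine Finset.sum_congr rfl fun k _ => ?_
    rw [finsum_eq_single _ (Finsupp.single k 1)]
    · simp
    · intro d hd
      simp [hd]
  · intro k _
    refine (Set.finite_singleton (Finsupp.single k 1)).subset fun d hd => ?_
    by_contra hne
    exact hd (if_neg hne)

end Substitution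

/-! ### The universal variational equation and its weights -/

section Generic

variable {K : Type*} [Field K] {m : ℕ}

/-- The variable `(s, i)` stands for the component `x_{s+1,i}`, of weight `s + 1`. -/
def veWeight (m : ℕ) : ℕ × Fin m → ℕ := fun s => s.1 + 1

/-- The components `x_{s,i}` with `1 ≤ s`, as values of the variables `(s - 1, i)`. -/
def veValues {L : Type*} (x : ℕ → Fin m → L) : ℕ × Fin m → L := fun s => x (s.1 + 1) s.2

variable (K m) in
/-- The deviation with indeterminate components. -/
noncomputable def genericDeviation (i : Fin m) : PowerSeries (MvPolynomial (ℕ × Fin m) K) :=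
  PowerSeries.mk fun s => if s = 0 then 0 else
    MvPolynomial.C ((s ! : K)⁻¹) * MvPolynomial.X (s - 1, i)

/-- The coefficient of `ε ^ q` in `v_j(x₀ + ξ)` as a polynomial in the components of `ξ`. -/
noncomputable def veCoeff (v : Fin m → MvPowerSeries (Fin m) K) (q : ℕ) (j : Fin m) :
    MvPolynomial (ℕ × Fin m) K :=
  PowerSeries.coeff q (MvPowerSeries.subst (genericDeviation K m) (v j) :
    PowerSeries (MvPolynomial (ℕ × Fin m) K))

theorem constantCoeff_deviation {L : Type*} [Field L] (x : ℕ → Fin m → L) (i : Fin m) :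
    PowerSeries.constantCoeff (deviation x i) = 0 := by
  rw [← PowerSeries.coeff_zero_eq_constantCoeff_apply, deviation, PowerSeries.coeff_mk, if_pos rfl]

theorem constantCoeff_genericDeviation (i : Fin m) :
    PowerSeries.constantCoeff (genericDeviation K m i) = 0 := by
  rw [← PowerSeries.coeff_zero_eq_constantCoeff_apply, genericDeviation, PowerSeries.coeff_mk,
    if_pos rfl]

theorem coeff_subst_deviation {L : Type*} [Field L] [Algebra K L]
    (v : Fin m → MvPowerSeries (Fin m) K) (x : ℕ → Fin m → L) (q : ℕ) (j : Fin m) :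
    PowerSeries.coeff q (MvPowerSeries.subst (deviation x) (v j) : PowerSeries L) =
      MvPolynomial.aeval (veValues x) (veCoeff v q j) := by
  rw [veCoeff, ← PowerSeries.coeff_mvSubst_map _ constantCoeff_genericDeviation]
  congr 2
  funext i
  ext s
  rw [PowerSeries.coeff_map, deviation, genericDeviation, PowerSeries.coeff_mk,
    PowerSeries.coeff_mk]
  by_cases hs : s = 0
  · simp [hs]
  · obtain ⟨s, rfl⟩ := Nat.exists_eq_succ_of_ne_zero hs
    simp [veValues, div_eq_inv_mul]

theorem isWeightedHomogeneous_veCoeff (v : Fin m → MvPowerSeries (Fin m) K) (q : ℕ) (j : Fin m) :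
    MvPolynomial.IsWeightedHomogeneous (veWeight m) (veCoeff v q j) q := by
  -- `P` says that the power of `ε` records the weight; it is stable under products, hence holds for
  -- every monomial in the generic deviation.
  let P : PowerSeries (MvPolynomial (ℕ × Fin m) K) → Prop := fun f =>
    ∀ n, MvPolynomial.IsWeightedHomogeneous (veWeight m) (PowerSeries.coeff n f) n
  have hone : P 1 := by
    intro n
    rw [PowerSeries.coeff_one]
    split_ifs with h
    · exact h ▸ MvPolynomial.isWeightedHomogeneous_one _ _
    · exact MvPolynomial.isWeightedHomogeneous_zero _ _ _
  have hmul : ∀ f g, P f → P g → P (f * g) := by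
    intro f g hf hg n
    rw [PowerSeries.coeff_mul]
    refine MvPolynomial.IsWeightedHomogeneous.sum _ _ _ fun c hc => ?_
    rw [← Finset.HasAntidiagonal.mem_antidiagonal.1 hc]
    exact (hf _).mul (hg _)
  have hgen : ∀ i, P (genericDeviation K m i) := by
    intro i n
    rw [genericDeviation, PowerSeries.coeff_mk]
    split_ifs with h
    · exact MvPolynomial.isWeightedHomogeneous_zero _ _ _
    · have := (MvPolynomial.isWeightedHomogeneous_X K (veWeight m) (n - 1, i)).C_mul ((n ! : K)⁻¹)
      have hn : veWeight m (n - 1, i) = n := Nat.sub_add_cancel (Nat.one_le_iff_ne_zero.2 h)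
      rwa [hn] at this
  have hprod : ∀ d : Fin m →₀ ℕ, P (d.prod fun s e => genericDeviation K m s ^ e) := by
    intro d
    refine Finset.prod_induction _ P hmul hone fun i _ => ?_
    generalize d i = e
    induction e with
    | zero => simpa using hone
    | succ e ih =>
      change P (genericDeviation K m i ^ (e + 1))
      rw [pow_succ]
      exact hmul _ _ ih (hgen i)
  rw [veCoeff, PowerSeries.coeff_mvSubst constantCoeff_genericDeviation,
    ← MvPolynomial.mem_weightedHomogeneousSubmodule]
  refine finsum_induction (· ∈ MvPolynomial.weightedHomogeneousSubmodule K (veWeight m) q)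
    (zero_mem _) (fun _ _ => add_mem) fun d => ?_
  exact Submodule.smul_mem _ _ (hprod d q)

/-- A variable of a monomial of weight `n` has index below `n`. -/
theorem lt_of_mem_support_of_weight {α : ℕ × Fin m →₀ ℕ} {s : ℕ × Fin m} (hs : s ∈ α.support) :
    s.1 < Finsupp.weight (veWeight m) α := by
  have h := Finsupp.le_weight_of_ne_zero' (veWeight m) (Finsupp.mem_support_iff.1 hs)
  exact h

theorem finite_weight_le (m p : ℕ) :
    {α : ℕ × Fin m →₀ ℕ | Finsupp.weight (veWeight m) α ≤ p}.Finite := by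
  -- All weights are at least 1, so both the indices and the exponents occurring are bounded by `p`.
  refine (Set.finite_Iic
    (∑ s ∈ Finset.range p ×ˢ (Finset.univ : Finset (Fin m)), Finsupp.single s p)).subset ?_
  intro α hα
  rw [Set.mem_Iic, Finsupp.le_iff]
  intro s hs
  have h1 : s.1 < p := (lt_of_mem_support_of_weight hs).trans_le hα
  have h2 : α s ≤ p := by
    refine le_trans ?_ hα
    exact Finsupp.le_weight (veWeight m) (by simp [veWeight]) α
  rw [Finsupp.finsetSum_apply, Finset.sum_eq_single_of_mem s]
  · simpa using h2
  · simpa using h1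
  · intro b _ hb
    simp [hb]

end Generic

/-! ### The variational equations in polynomial and in linear form -/

section Solutions

variable {K L : Type*} [Field K] [Field L] [CharZero L] [Differential L] [Algebra K L]
  {m : ℕ} {v : Fin m → MvPowerSeries (Fin m) K} {p : ℕ} {x y : ℕ → Fin m → L}

theorem isVESolution_iff : IsVESolution v p x ↔
    ∀ q, 1 ≤ q → q ≤ p → ∀ j,
      (x q j)′ = (q ! : L) * MvPolynomial.aeval (veValues x) (veCoeff v q j) := by
  unfold IsVESolution
  simp only [coeff_subst_deviation]
  refine forall_congr' fun q => forall_congr' fun _ => forall_congr' fun _ => forall_congr'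
    fun j => ?_
  rw [div_eq_iff (by exact_mod_cast q.factorial_ne_zero), mul_comm]

omit [CharZero L] [Differential L] in
/-- The value of a polynomial of weight at most `p` depends only on `x_1, …, x_p`. -/
theorem aeval_veValues_congr {P : MvPolynomial (ℕ × Fin m) K}
    (hP : ∀ α ∈ P.support, Finsupp.weight (veWeight m) α ≤ p)
    (h : ∀ s, 1 ≤ s → s ≤ p → x s = y s) :
    MvPolynomial.aeval (veValues x) P = MvPolynomial.aeval (veValues y) P := by
  rw [MvPolynomial.aeval_def, MvPolynomial.aeval_def, MvPolynomial.eval₂_eq,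
    MvPolynomial.eval₂_eq]
  refine Finset.sum_congr rfl fun α hα => congrArg _ (Finset.prod_congr rfl fun s hs => ?_)
  have : s.1 < p := (lt_of_mem_support_of_weight hs).trans_le (hP α hα)
  simp [veValues, h (s.1 + 1) (by omega) (by omega)]

theorem weight_le_of_mem_support_veCoeff {q : ℕ} {j : Fin m} {α : ℕ × Fin m →₀ ℕ}
    (hα : α ∈ (veCoeff v q j).support) : Finsupp.weight (veWeight m) α ≤ q :=
  (isWeightedHomogeneous_veCoeff v q j (MvPolynomial.mem_support_iff.1 hα)).le

theorem IsVESolution.congr (hx : IsVESolution v p x) (h : ∀ s, 1 ≤ s → s ≤ p → x s = y s) :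
    IsVESolution v p y := by
  rw [isVESolution_iff] at hx ⊢
  intro q h1 hq j
  rw [← h q h1 hq, hx q h1 hq j, aeval_veValues_congr
    (fun α hα => (weight_le_of_mem_support_veCoeff hα).trans hq) h]

omit [CharZero L] in
theorem IsVESolution.mono {q : ℕ} (hx : IsVESolution v p x) (hq : q ≤ p) : IsVESolution v q x :=
  fun r h1 hr => hx r h1 (hr.trans hq)

/-- The linear part of the variational equations. -/
noncomputable def veMatrix (v : Fin m → MvPowerSeries (Fin m) K) : Matrix (Fin m) (Fin m) K :=
  fun j k => MvPowerSeries.coeff (Finsupp.single k 1) (v j)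

/-- The inhomogeneity `f_{q+1}` of the variational equation of order `q + 1`. -/
noncomputable def veInhomogeneity (v : Fin m → MvPowerSeries (Fin m) K) (q : ℕ)
    (x : ℕ → Fin m → L) (j : Fin m) : L :=
  ((q + 1) ! : L) * MvPolynomial.aeval (veValues (Function.update x (q + 1) 0))
    (veCoeff v (q + 1) j)

omit [CharZero L] [Differential L] in
theorem veInhomogeneity_congr {q : ℕ} (h : ∀ s, 1 ≤ s → s ≤ q → x s = y s) :
    veInhomogeneity v q x = veInhomogeneity v q y := by
  funext j
  unfold veInhomogeneity
  rw [aeval_veValues_congr (p := q + 1) (fun α => weight_le_of_mem_support_veCoeff)]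
  intro s h1 hs
  rcases Nat.lt_or_eq_of_le hs with h2 | rfl
  · rw [Function.update_of_ne h2.ne, Function.update_of_ne h2.ne, h s h1 (by omega)]
  · simp

omit [Differential L] in
-- Setting `x (q + 1)` to zero alters the deviation only from degree `q + 1` on, so it removes
-- exactly the linear part in `x (q + 1)`; the factorial cancels the denominator in the deviation.
theorem factorial_mul_aeval_veCoeff (x : ℕ → Fin m → L) (q : ℕ) (j : Fin m) :
    ((q + 1) ! : L) * MvPolynomial.aeval (veValues x) (veCoeff v (q + 1) j) =
      ∑ k, algebraMap K L (veMatrix v j k) * x (q + 1) k + veInhomogeneity v q x j := by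
  have hne : ((q + 1) ! : L) ≠ 0 := by exact_mod_cast (q + 1).factorial_ne_zero
  have h := PowerSeries.coeff_mvSubst_sub (q := q + 1) (constantCoeff_deviation x)
    (constantCoeff_deviation (Function.update x (q + 1) 0)) (fun i n hn => by
      simp [deviation, Function.update_of_ne hn.ne]) (v j)
  rw [coeff_subst_deviation, coeff_subst_deviation, sub_eq_iff_eq_add] at h
  rw [h, mul_add, veInhomogeneity, Finset.mul_sum]
  congr 1
  refine Finset.sum_congr rfl fun k _ => ?_
  simp only [deviation, PowerSeries.coeff_mk, Algebra.smul_def, veMatrix]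
  simp
  field_simp

/-- The variational equation of order `q + 1` is `x_{q+1}′ = A x_{q+1} + f_{q+1}`. -/
theorem isVESolution_succ_iff {q : ℕ} : IsVESolution v (q + 1) x ↔
    IsVESolution v q x ∧ ∀ j, (x (q + 1) j)′ =
      ∑ k, algebraMap K L (veMatrix v j k) * x (q + 1) k + veInhomogeneity v q x j := by
  constructor
  · intro h
    refine ⟨h.mono q.le_succ, fun j => ?_⟩
    rw [← factorial_mul_aeval_veCoeff]
    exact isVESolution_iff.1 h (q + 1) (by omega) le_rfl j
  · rintro ⟨h1, h2⟩
    rw [isVESolution_iff] at h1 ⊢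
    intro r hr hrq j
    rcases Nat.lt_or_eq_of_le hrq with h3 | rfl
    · exact h1 r hr (by omega) j
    · rw [h2 j, factorial_mul_aeval_veCoeff]

omit [CharZero L] in
theorem isVESolution_zero : IsVESolution v 0 x := fun q h1 h2 => by omega

omit [CharZero L] [Differential L] in
-- A monomial of weight 1 contains some component of `x 1`, which the inhomogeneity replaces by
-- zero.
theorem veInhomogeneity_zero : veInhomogeneity v 0 x = 0 := by
  funext j
  rw [veInhomogeneity_congr (y := 0) (fun s h1 h2 => by omega), veInhomogeneity,
    MvPolynomial.aeval_def, MvPolynomial.eval₂_eq, Finset.sum_eq_zero, mul_zero]; · rfl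
  intro α hα
  have hw := isWeightedHomogeneous_veCoeff v (0 + 1) j (MvPolynomial.mem_support_iff.1 hα)
  obtain ⟨s, hs⟩ : α.support.Nonempty := by
    rw [Finsupp.support_nonempty_iff]
    rintro rfl
    simp at hw
  rw [Finset.prod_eq_zero hs, mul_zero]
  rw [veValues]
  have : s.1 = 0 := by have := lt_of_mem_support_of_weight hs; omega
  simp [this, Finsupp.mem_support_iff.1 hs]

/-- Differential homomorphisms map solutions to solutions, and reflect them. -/
theorem IsVESolution.map_iff {E : Type*} [Field E] [CharZero E] [Differential E] [Algebra K E]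
    (g : E →ₐ[K] L) (hg : ∀ a, g (a′) = (g a)′) {z : ℕ → Fin m → E} :
    IsVESolution v p (fun s i => g (z s i)) ↔ IsVESolution v p z := by
  rw [isVESolution_iff, isVESolution_iff]
  refine forall_congr' fun q => forall_congr' fun _ => forall_congr' fun _ => forall_congr'
    fun j => ?_
  have : veValues (fun s i => g (z s i)) = fun s => g (veValues z s) := rfl
  rw [← hg, this, ← MvPolynomial.comp_aeval_apply, ← map_natCast g, ← map_mul]
  exact (g : E →+* L).injective.eq_iff

end Solutions

/-! ### Linearization by monomials of bounded weight -/

section Linearization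

variable {K L : Type*} [Field K] [Field L] [Differential L] [Algebra K L] {m : ℕ}

variable (L) in
-- Leibniz's rule: each equation replaces the derivative of a variable by a polynomial of the same
-- weight. One `P` serves all solutions.
theorem exists_deriv_aeval_monomial [CharZero L] (v : Fin m → MvPowerSeries (Fin m) K)
    (α : ℕ × Fin m →₀ ℕ) : ∃ P : MvPolynomial (ℕ × Fin m) K,
      MvPolynomial.IsWeightedHomogeneous (veWeight m) P (Finsupp.weight (veWeight m) α) ∧
      ∀ x : ℕ → Fin m → L, IsVESolution v (Finsupp.weight (veWeight m) α) x →
        (MvPolynomial.aeval (veValues x) (MvPolynomial.monomial α (1 : K)))′ =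
          MvPolynomial.aeval (veValues x) P := by
  let C : (ℕ × Fin m →₀ ℕ) → Prop := fun α => ∃ P : MvPolynomial (ℕ × Fin m) K,
      MvPolynomial.IsWeightedHomogeneous (veWeight m) P (Finsupp.weight (veWeight m) α) ∧
      ∀ x : ℕ → Fin m → L, IsVESolution v (Finsupp.weight (veWeight m) α) x →
        (MvPolynomial.aeval (veValues x) (MvPolynomial.monomial α (1 : K)))′ =
          MvPolynomial.aeval (veValues x) P
  have hzero : C 0 := by
    refine ⟨0, MvPolynomial.isWeightedHomogeneous_zero _ _ _, fun x _ => ?_⟩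
    rw [MvPolynomial.monomial_zero', map_one, map_one, map_zero, Derivation.map_one_eq_zero]
  have hadd : ∀ α β, C α → C β → C (α + β) := by
    rintro α β ⟨P, hP, hP'⟩ ⟨Q, hQ, hQ'⟩
    refine ⟨MvPolynomial.monomial α 1 * Q + MvPolynomial.monomial β 1 * P, ?_, fun x hx => ?_⟩
    · rw [map_add]
      refine ((MvPolynomial.isWeightedHomogeneous_monomial _ α 1 rfl).mul hQ).add ?_
      rw [add_comm (Finsupp.weight _ α)]
      exact (MvPolynomial.isWeightedHomogeneous_monomial _ β 1 rfl).mul hP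
    · have : (MvPolynomial.monomial (α + β) (1 : K)) =
        MvPolynomial.monomial α 1 * MvPolynomial.monomial β 1 := by
        rw [MvPolynomial.monomial_mul, one_mul]
      rw [map_add] at hx
      rw [this, map_mul, Derivation.leibniz, smul_eq_mul, smul_eq_mul,
        hP' x (hx.mono (Nat.le_add_right _ _)), hQ' x (hx.mono (Nat.le_add_left _ _)),
        map_add, map_mul, map_mul]
  have hone : ∀ s, C (Finsupp.single s 1) := by
    intro s
    have hw : Finsupp.weight (veWeight m) (Finsupp.single s 1) = s.1 + 1 := by
      rw [Finsupp.weight_single, one_smul]; rfl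
    simp only [C, hw]
    refine ⟨MvPolynomial.C (((s.1 + 1) ! : ℕ) : K) * veCoeff v (s.1 + 1) s.2,
      (isWeightedHomogeneous_veCoeff v _ _).C_mul _, fun x hx => ?_⟩
    have : MvPolynomial.monomial (Finsupp.single s 1) (1 : K) = MvPolynomial.X s := rfl
    rw [this, MvPolynomial.aeval_X, map_mul, MvPolynomial.aeval_C, map_natCast]
    exact isVESolution_iff.1 hx (s.1 + 1) (by omega) le_rfl s.2
  change C α
  induction α using Finsupp.induction_linear with
  | zero => exact hzero
  | add α β hα hβ => exact hadd α β hα hβ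
  | single s n =>
    induction n with
    | zero => rw [Finsupp.single_zero]; exact hzero
    | succ n ih => rw [Finsupp.single_add]; exact hadd _ _ ih (hone s)

/-- The exponents of the monomials of weight at most `p` in the components of the deviation. -/
abbrev VEExponent (m p : ℕ) : Type := {α : ℕ × Fin m →₀ ℕ // Finsupp.weight (veWeight m) α ≤ p}

noncomputable instance (m p : ℕ) : Fintype (VEExponent m p) := (finite_weight_le m p).fintype

variable (K) in
/-- The values of the monomials of weight at most `p`. -/
noncomputable def veMonomials (p : ℕ) (x : ℕ → Fin m → L) : VEExponent m p → L := fun α =>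
  MvPolynomial.aeval (veValues x) (MvPolynomial.monomial α.1 (1 : K))

omit [Differential L] in
theorem veMonomials_eq_prod (p : ℕ) (x : ℕ → Fin m → L) (α : VEExponent m p) :
    veMonomials K p x α = α.1.prod fun s e => veValues x s ^ e := by
  rw [veMonomials, MvPolynomial.aeval_monomial, map_one, one_mul]

/-- The exponent of the monomial `x_{q,i}`. -/
noncomputable def componentExponent {p q : ℕ} (hq : 1 ≤ q) (hqp : q ≤ p) (i : Fin m) :
    VEExponent m p :=
  ⟨Finsupp.single (q - 1, i) 1, by
    rw [Finsupp.weight_single, one_smul]; simp only [veWeight]; omega⟩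

omit [Differential L] in
theorem veMonomials_componentExponent {p q : ℕ} (hq : 1 ≤ q) (hqp : q ≤ p) (i : Fin m)
    (x : ℕ → Fin m → L) : veMonomials K p x (componentExponent hq hqp i) = x q i := by
  rw [veMonomials_eq_prod, componentExponent]
  refine (Finsupp.prod_single_index (h := fun s e => veValues x s ^ e) (pow_zero _)).trans ?_
  rw [pow_one, veValues, Nat.sub_add_cancel hq]

/-- The monomials of weight at most `p` satisfy a linear differential system over `K`. -/
theorem exists_linearization [CharZero L] (v : Fin m → MvPowerSeries (Fin m) K) (p : ℕ) :
    ∃ B : Matrix (VEExponent m p) (VEExponent m p) K, ∀ x : ℕ → Fin m → L, IsVESolution v p x →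
      ∀ α, (veMonomials K p x α)′ = ∑ β, algebraMap K L (B α β) * veMonomials K p x β := by
  choose P hP hP' using fun α => exists_deriv_aeval_monomial L v (m := m) α
  refine ⟨fun α β => (P α.1).coeff β.1, fun x hx α => ?_⟩
  rw [veMonomials, hP' α.1 x (hx.mono α.2)]
  conv_lhs => rw [(P α.1).as_sum, map_sum]
  -- Weight preservation keeps the derivative within weight `p`, so the system closes up.
  have hsub : (P α.1).support ⊆
      (Finset.univ : Finset (VEExponent m p)).map (Function.Embedding.subtype _) := by
    intro β hβ
    have : Finsupp.weight (veWeight m) β ≤ p :=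
      (hP α.1 (MvPolynomial.mem_support_iff.1 hβ)).le.trans α.2
    simpa using this
  rw [Finset.sum_subset hsub, Finset.sum_map]
  · refine Finset.sum_congr rfl fun β _ => ?_
    rw [veMonomials_eq_prod, MvPolynomial.aeval_monomial]
    rfl
  · intro β _ hβ
    rw [MvPolynomial.notMem_support_iff.1 hβ, MvPolynomial.monomial_zero, map_zero]

end Linearization

/-! ### Zariski density of the solutions -/

section Density

variable {K L : Type*} [Field K] [Differential K] [Field L] [CharZero L] [Differential L]
  [Algebra K L] [DifferentialAlgebra K L] {m : ℕ} {v : Fin m → MvPowerSeries (Fin m) K}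

/-- `X` is a fundamental matrix of the first variational equation. -/
def IsVEFundamental (v : Fin m → MvPowerSeries (Fin m) K) (X : Matrix (Fin m) (Fin m) L) : Prop :=
  IsUnit X.det ∧ X.map (fun y => y′) = (veMatrix v).map (algebraMap K L) * X

omit [Differential K] [DifferentialAlgebra K L] in
theorem HasGeneralVESolution.exists_fundamental (hv : HasGeneralVESolution L v) :
    ∃ X : Matrix (Fin m) (Fin m) L, IsVEFundamental v X ∧
      ∀ k, IsVESolution v 1 (fun _ i => X i k) := by
  obtain ⟨X, hX, hX'⟩ := hv.1
  refine ⟨X, ⟨hX, ?_⟩, hX'⟩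
  ext i k
  have := (isVESolution_succ_iff.1 (hX' k)).2 i
  rw [veInhomogeneity_zero] at this
  rw [Matrix.map_apply, this, Matrix.mul_apply]
  simp

omit [Differential K] [DifferentialAlgebra K L] in
theorem HasGeneralVESolution.exists_extend (hv : HasGeneralVESolution L v) {q : ℕ}
    {x : ℕ → Fin m → L} (hx : IsVESolution v q x) :
    ∃ z : ℕ → Fin m → L, IsVESolution v (q + 1) z ∧ ∀ s, 1 ≤ s → s ≤ q → z s = x s := by
  rcases Nat.eq_zero_or_pos q with rfl | hq
  · refine ⟨0, isVESolution_succ_iff.2 ⟨isVESolution_zero, fun j => ?_⟩, fun s h1 h2 => by omega⟩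
    simp [veInhomogeneity_zero]
  · exact hv.2 q hq x hx

omit [Differential K] [DifferentialAlgebra K L] in
/-- Solutions of the linear part may be added to the last component. -/
theorem IsVESolution.update_add {q : ℕ} {z : ℕ → Fin m → L} (hz : IsVESolution v (q + 1) z)
    {w : Fin m → L} (hw : ∀ j, (w j)′ = ∑ k, algebraMap K L (veMatrix v j k) * w k) :
    IsVESolution v (q + 1) (Function.update z (q + 1) (z (q + 1) + w)) := by
  have hcongr : ∀ s, 1 ≤ s → s ≤ q → z s = Function.update z (q + 1) (z (q + 1) + w) s := by
    intro s _ hs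
    rw [Function.update_of_ne (by omega)]
  rw [isVESolution_succ_iff] at hz ⊢
  refine ⟨hz.1.congr hcongr, fun j => ?_⟩
  rw [← veInhomogeneity_congr hcongr]
  simp only [Function.update_self, Pi.add_apply, map_add, hz.2 j, hw j, mul_add,
    Finset.sum_add_distrib]
  ring

/-- The solutions of the variational equations are Zariski dense. -/
theorem HasGeneralVESolution.eq_zero_of_aeval_eq_zero (hv : HasGeneralVESolution L v)
    {C : Set K} (hC : C.Infinite) (hC' : ∀ c ∈ C, c′ = 0) (p : ℕ)
    (Q : MvPolynomial (ℕ × Fin m) L)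
    (hQ : ∀ x : ℕ → Fin m → L, IsVESolution v p x → MvPolynomial.eval (veValues x) Q = 0) :
    Q = 0 := by
  induction p with
  | zero =>
    -- At order 0 there is no condition, so `Q` vanishes at every point; the shift `s - 1` undoes
    -- the one in `veValues`.
    refine MvPolynomial.funext fun u => ?_
    rw [map_zero]
    exact hQ (fun s i => u (s - 1, i)) isVESolution_zero
  | succ p ih =>
    refine ih fun x hx => ?_
    obtain ⟨z, hz, hzx⟩ := hv.exists_extend hx
    obtain ⟨X, ⟨hXu, hX⟩, -⟩ := hv.exists_fundamental
    -- Along the affine space `z (p + 1) + X c`, with `c` indeterminate, `Q` becomes a polynomial in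
    -- `c`. It vanishes at all `c` with entries in the infinite set `C` of constants, hence
    -- identically.
    let sub : ℕ × Fin m → MvPolynomial (Fin m) L := fun s =>
      if s.1 = p then MvPolynomial.C (z (p + 1) s.2) +
        ∑ k, MvPolynomial.C (X s.2 k) * MvPolynomial.X k
      else MvPolynomial.C (x (s.1 + 1) s.2)
    have hsub : ∀ c : Fin m → L, MvPolynomial.eval c (MvPolynomial.aeval sub Q) =
        MvPolynomial.eval (veValues (Function.update x (p + 1) (z (p + 1) + X.mulVec c))) Q := by
      intro c
      have : (MvPolynomial.eval c).comp (MvPolynomial.aeval sub : _ →ₐ[L] _).toRingHom =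
          MvPolynomial.eval (veValues (Function.update x (p + 1) (z (p + 1) + X.mulVec c))) := by
        refine MvPolynomial.ringHom_ext (fun a => ?_) fun s => ?_
        · simp
        · by_cases hs : s.1 = p
          · simp [sub, veValues, hs, Matrix.mulVec, dotProduct]
          · simp [sub, veValues, hs]
      exact congrArg (fun g => g Q) this
    have hzero : MvPolynomial.aeval sub Q = 0 := by
      refine MvPolynomial.funext_set (fun _ => algebraMap K L '' C)
        (fun _ => hC.image (algebraMap K L).injective.injOn) fun c hc => ?_
      rw [hsub, map_zero]
      have hc' : ∀ k, (c k)′ = 0 := by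
        intro k
        obtain ⟨a, ha, hak⟩ := hc k (Set.mem_univ k)
        rw [← hak, deriv_algebraMap, hC' a ha, map_zero]
      refine hQ _ ((hz.update_add (w := X.mulVec c) fun j => ?_).congr ?_)
      · have hX' : ∀ i k, (X i k)′ = ∑ l, algebraMap K L (veMatrix v i l) * X l k := fun i k => by
          have := congrFun (congrFun hX i) k
          simpa [Matrix.mul_apply] using this
        simp only [Matrix.mulVec, dotProduct, map_sum, Derivation.leibniz, hc', hX', smul_eq_mul,
          Finset.mul_sum, mul_zero, zero_add]
        rw [Finset.sum_comm]
        exact Finset.sum_congr rfl fun k _ => Finset.sum_congr rfl fun l _ => by ring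
      · intro s h1 hs
        rcases Nat.lt_or_eq_of_le hs with h2 | rfl
        · rw [Function.update_of_ne h2.ne, Function.update_of_ne h2.ne, hzx s h1 (by omega)]
        · rw [Function.update_self, Function.update_self]
    -- A non-constant `c` is now allowed, and this choice reaches the arbitrary value `x (p + 1)`.
    have hlast : Function.update x (p + 1)
        (z (p + 1) + X.mulVec (X⁻¹.mulVec (x (p + 1) - z (p + 1)))) = x := by
      rw [Matrix.mulVec_mulVec, Matrix.mul_nonsing_inv X hXu, Matrix.one_mulVec,
        add_sub_cancel, Function.update_eq_self]
    rw [← hlast, ← hsub, hzero, map_zero]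

end Density

/-! ### Holonomic elements and finite-dimensional differential modules -/

section Holonomic

variable {K L : Type*} [Field K] [Differential K] [Field L] [Differential L] [Algebra K L]
  [DifferentialAlgebra K L]

/-- A subspace spanned by a set whose derivatives it contains is closed under the derivation. -/
theorem deriv_mem_span {S : Set L} (hS : ∀ s ∈ S, s′ ∈ Submodule.span K S) {x : L}
    (hx : x ∈ Submodule.span K S) : x′ ∈ Submodule.span K S := by
  induction hx using Submodule.span_induction with
  | mem x hx => exact hS x hx
  | zero => rw [map_zero]; exact zero_mem _
  | add x y _ _ hx hy => rw [map_add]; exact add_mem hx hy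
  | smul a x hx hx' =>
    rw [Algebra.smul_def, Derivation.leibniz, deriv_algebraMap, smul_eq_mul, smul_eq_mul,
      mul_comm x, ← Algebra.smul_def, ← Algebra.smul_def]
    exact add_mem (Submodule.smul_mem _ _ hx') (Submodule.smul_mem _ _ hx)

theorem deriv_mem_adjoin {S : Set L} (hS : ∀ s ∈ S, s′ ∈ IntermediateField.adjoin K S) {x : L}
    (hx : x ∈ IntermediateField.adjoin K S) : x′ ∈ IntermediateField.adjoin K S := by
  induction hx using IntermediateField.adjoin_induction with
  | mem x hx => exact hS x hx
  | algebraMap a => rw [deriv_algebraMap]; exact IntermediateField.algebraMap_mem _ _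
  | add x y _ _ hx hy => rw [map_add]; exact add_mem hx hy
  | inv x hx hx' =>
    rw [Derivation.leibniz_inv, smul_eq_mul]
    exact mul_mem (neg_mem (pow_mem (inv_mem hx) 2)) hx'
  | mul x y hx hy hx' hy' =>
    rw [Derivation.leibniz, smul_eq_mul, smul_eq_mul]
    exact add_mem (mul_mem hx hy') (mul_mem hy hx')

variable (K L) in
/-- The elements that lie in a finite-dimensional subspace closed under the derivation. -/
def differentiallyFinite : Subalgebra K L where
  carrier := {y | ∃ W : Submodule K L, W.FG ∧ (∀ w ∈ W, w′ ∈ W) ∧ y ∈ W}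
  add_mem' := by
    rintro a b ⟨W, hW, hW', ha⟩ ⟨V, hV, hV', hb⟩
    refine ⟨W ⊔ V, hW.sup hV, fun w hw => ?_, add_mem (Submodule.mem_sup_left ha)
      (Submodule.mem_sup_right hb)⟩
    obtain ⟨c, hc, d, hd, rfl⟩ := Submodule.mem_sup.1 hw
    rw [map_add]
    exact add_mem (Submodule.mem_sup_left (hW' c hc)) (Submodule.mem_sup_right (hV' d hd))
  mul_mem' := by
    rintro a b ⟨W, hW, hW', ha⟩ ⟨V, hV, hV', hb⟩
    refine ⟨W * V, hW.mul hV, fun w hw => ?_, Submodule.mul_mem_mul ha hb⟩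
    induction hw using Submodule.mul_induction_on' with
    | mem_mul_mem c hc d hd =>
      rw [Derivation.leibniz, smul_eq_mul, smul_eq_mul, mul_comm d]
      exact add_mem (Submodule.mul_mem_mul hc (hV' d hd)) (Submodule.mul_mem_mul (hW' c hc) hd)
    | add x _ y _ hx hy => rw [map_add]; exact add_mem hx hy
  algebraMap_mem' := by
    intro r
    refine ⟨1, Submodule.one_eq_span (R := K) (A := L) ▸ Submodule.fg_span_singleton _, fun w hw => ?_, Submodule.algebraMap_mem r⟩
    obtain ⟨a, rfl⟩ := Submodule.mem_one.1 hw
    rw [deriv_algebraMap]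
    exact Submodule.algebraMap_mem _

theorem mem_differentiallyFinite_of_linear_system {ι : Type*} [Finite ι] {y : ι → L}
    (hy : ∀ i, (y i)′ ∈ Submodule.span K (Set.range y)) (i : ι) :
    y i ∈ differentiallyFinite K L := by
  refine ⟨Submodule.span K (Set.range y), Submodule.fg_span (Set.finite_range y), fun w hw =>
    deriv_mem_span ?_ hw, Submodule.subset_span ⟨i, rfl⟩⟩
  rintro _ ⟨j, rfl⟩
  exact hy j

/-- In a space of dimension `n` closed under the derivation, `y` and its first `n` derivatives are
linearly dependent. -/
theorem isHolonomic_of_mem_differentiallyFinite {y : L} (hy : y ∈ differentiallyFinite K L) :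
    IsHolonomic K y := by
  obtain ⟨W, hW, hW', hy⟩ := hy
  have : Module.Finite K W := Module.Finite.iff_fg.2 hW
  let n := Module.finrank K W
  have hmem : ∀ i : ℕ, (fun z : L => z′)^[i] y ∈ W := by
    intro i
    induction i with
    | zero => exact hy
    | succ i ih => rw [Function.iterate_succ_apply']; exact hW' _ ih
  have hdep : ¬ LinearIndependent K fun i : Fin (n + 1) => (⟨_, hmem i⟩ : W) := by
    intro h
    have := h.fintype_card_le_finrank
    simp [n] at this
  obtain ⟨c, hc, i, hi⟩ := Fintype.not_linearIndependent_iff.1 hdep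
  refine ⟨n, c, fun h => hi (by rw [h]; rfl), ?_⟩
  have := congrArg (Subtype.val) hc
  simpa [Algebra.smul_def] using this

end Holonomic

/-! ### Linear systems: variation of constants and the dual system -/

section LinearSystem

variable {K L : Type*} [Field K] [Differential K] [Field L] [Differential L] [Algebra K L]
  [DifferentialAlgebra K L] {ι : Type*} [Fintype ι] [DecidableEq ι]
  {A : Matrix ι ι L} {X : Matrix ι ι L} {y f : ι → L}

omit [Differential K] [Algebra K L] [DifferentialAlgebra K L] [DecidableEq ι] in
theorem deriv_mulVec (X : Matrix ι ι L) (c : ι → L) :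
    (fun i => (X.mulVec c i)′) =
      (X.map fun y => y′).mulVec c + X.mulVec fun i => (c i)′ := by
  funext i
  simp only [Matrix.mulVec, dotProduct, map_sum, Derivation.leibniz, smul_eq_mul, Pi.add_apply,
    Matrix.map_apply, Finset.sum_add_distrib]
  rw [add_comm]
  congr 1
  exact Finset.sum_congr rfl fun k _ => mul_comm _ _

omit [Differential K] [Algebra K L] [DifferentialAlgebra K L] [DecidableEq ι] in
theorem matrix_deriv_mul (M N : Matrix ι ι L) :
    (M * N).map (fun y => y′) = (M.map fun y => y′) * N + M * N.map fun y => y′ := by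
  ext i j
  simp only [Matrix.mul_apply, Matrix.map_apply, Matrix.add_apply, map_sum, Derivation.leibniz,
    smul_eq_mul, Finset.sum_add_distrib]
  rw [add_comm]
  congr 1
  exact Finset.sum_congr rfl fun k _ => mul_comm _ _

omit [Differential K] [Algebra K L] [DifferentialAlgebra K L] in
/-- Variation of constants. -/
theorem deriv_inv_mulVec (hX : IsUnit X.det) (hX' : X.map (fun y => y′) = A * X)
    (hy : (fun i => (y i)′) = A.mulVec y + f) :
    (fun i => (X⁻¹.mulVec y i)′) = X⁻¹.mulVec f := by
  have h := deriv_mulVec X (X⁻¹.mulVec y)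
  rw [Matrix.mulVec_mulVec, Matrix.mul_nonsing_inv X hX, Matrix.one_mulVec, hy, hX',
    Matrix.mulVec_mulVec, Matrix.mul_assoc, Matrix.mul_nonsing_inv X hX, Matrix.mul_one] at h
  rw [add_left_cancel h, Matrix.mulVec_mulVec, Matrix.nonsing_inv_mul X hX, Matrix.one_mulVec]

omit [Differential K] [DifferentialAlgebra K L] in
/-- Solutions are combinations of the columns of a fundamental matrix, with constant
coefficients. -/
theorem exists_const_mulVec (hL : ∀ y : L, y′ = 0 → ∃ a : K, algebraMap K L a = y)
    (hX : IsUnit X.det) (hX' : X.map (fun y => y′) = A * X)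
    (hy : (fun i => (y i)′) = A.mulVec y) :
    ∃ c : ι → K, y = X.mulVec fun i => algebraMap K L (c i) := by
  have h := deriv_inv_mulVec (f := 0) hX hX' (by rw [hy, add_zero])
  rw [Matrix.mulVec_zero] at h
  choose c hc using fun i => hL _ (congrFun h i)
  refine ⟨c, ?_⟩
  simp only [hc]
  rw [Matrix.mulVec_mulVec, Matrix.mul_nonsing_inv X hX, Matrix.one_mulVec]

/-- The entries of the inverse of a fundamental matrix solve the dual system. -/
theorem inv_entry_mem_differentiallyFinite {B : Matrix ι ι K} (hX : IsUnit X.det)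
    (hX' : X.map (fun y => y′) = B.map (algebraMap K L) * X) (i j : ι) :
    X⁻¹ i j ∈ differentiallyFinite K L := by
  have hder : ∀ i, (fun j => (X⁻¹ i j)′) = fun j => ∑ k, (-B k j) • X⁻¹ i k := by
    intro i
    -- Differentiating `X⁻¹ * X = 1` yields the dual system for the rows of `X⁻¹`.
    have h : (X⁻¹ * X).map (fun y => y′) = 0 := by
      rw [Matrix.nonsing_inv_mul X hX]
      ext k l
      rcases eq_or_ne k l with rfl | hkl
      · simp
      · simp [hkl]
    have h2 : (X⁻¹.map fun y => y′) = -(X⁻¹ * B.map (algebraMap K L)) := by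
      rw [matrix_deriv_mul, hX', ← Matrix.mul_assoc, ← add_mul] at h
      have h3 := congrArg (· * X⁻¹) h
      simp only [Matrix.mul_assoc, Matrix.mul_nonsing_inv X hX, Matrix.mul_one, zero_mul] at h3
      exact eq_neg_of_add_eq_zero_left h3
    funext j
    have := congrFun (congrFun h2 i) j
    rw [Matrix.map_apply] at this
    rw [this, Matrix.neg_apply, Matrix.mul_apply, ← Finset.sum_neg_distrib]
    refine Finset.sum_congr rfl fun k _ => ?_
    rw [Matrix.map_apply, Algebra.smul_def, map_neg]
    ring
  refine mem_differentiallyFinite_of_linear_system (y := fun s : ι × ι => X⁻¹ s.1 s.2)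
    (fun s => ?_) (i, j)
  rw [congrFun (hder s.1) s.2]
  exact Submodule.sum_mem _ fun k _ => Submodule.smul_mem _ _
    (Submodule.subset_span ⟨(s.1, k), rfl⟩)

end LinearSystem

/-! ### Fundamental families of solutions -/

section Fundamental

variable {K L : Type*} [Field K] [Differential K] [Field L] [CharZero L] [Differential L]
  [Algebra K L] [DifferentialAlgebra K L] {m : ℕ} {v : Fin m → MvPowerSeries (Fin m) K} {p : ℕ}

/-- Finitely many solutions `x^{(k)}` of the variational equations form a fundamental family if
their monomials form an invertible matrix. -/
def IsFundamentalFamily (v : Fin m → MvPowerSeries (Fin m) K) (p : ℕ)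
    (x : VEExponent m p → ℕ → Fin m → L) : Prop :=
  (∀ k, IsVESolution v p (x k)) ∧
    IsUnit (Matrix.of fun α k => veMonomials K p (x k) α).det

theorem HasGeneralVESolution.exists_fundamentalFamily (hv : HasGeneralVESolution L v)
    (hC : {c : K | c′ = 0}.Infinite) (p : ℕ) :
    ∃ x : VEExponent m p → ℕ → Fin m → L, IsFundamentalFamily v p x := by
  let S : Set (VEExponent m p → L) := {y | ∃ x, IsVESolution v p x ∧ veMonomials K p x = y}
  have hspan : ⊤ ≤ Submodule.span L S := by
    by_contra hne
    obtain ⟨l, hl, hl'⟩ := Submodule.exists_le_ker_of_lt_top _ (lt_top_iff_ne_top.2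
      fun h => hne h.ge)
    apply hl
    -- A linear form killing all monomial vectors of solutions is a polynomial vanishing on all
    -- solutions, so by density its coefficients are zero.
    let Q : MvPolynomial (ℕ × Fin m) L :=
      ∑ α : VEExponent m p, MvPolynomial.monomial α.1 (l (Pi.single α 1))
    have hQ : Q = 0 := by
      refine hv.eq_zero_of_aeval_eq_zero hC (fun _ h => h) p Q fun x hx => ?_
      have h0 : l (veMonomials K p x) = 0 := hl' (Submodule.subset_span ⟨x, hx, rfl⟩)
      rw [LinearMap.pi_apply_eq_sum_univ] at h0
      rw [← h0, map_sum]
      refine Finset.sum_congr rfl fun α _ => ?_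
      rw [MvPolynomial.eval_monomial, veMonomials_eq_prod, smul_eq_mul, mul_comm]
      congr 2
      funext β
      simp [Pi.single_apply, eq_comm]
    refine LinearMap.pi_ext' fun α => LinearMap.ext_ring ?_
    have := congrArg (MvPolynomial.coeff α.1) hQ
    rw [MvPolynomial.coeff_sum, Finset.sum_eq_single α, MvPolynomial.coeff_monomial,
      if_pos rfl] at this
    · simpa using this
    · intro β _ hβ
      rw [MvPolynomial.coeff_monomial, if_neg fun h => hβ (Subtype.ext h)]
    · simp
  let b := Module.Basis.ofSpan hspan
  have hb : ∀ i, b i ∈ S := fun i => Module.Basis.ofSpan_subset hspan ⟨i, rfl⟩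
  -- A basis extracted from the spanning set has as many elements as there are exponents, which
  -- makes the matrix square.
  let e := b.indexEquiv (Pi.basisFun L (VEExponent m p))
  let b' := b.reindex e
  choose x hx hx' using fun k => hb (e.symm k)
  refine ⟨x, hx, ?_⟩
  rw [← Matrix.isUnit_iff_isUnit_det, ← Matrix.linearIndependent_cols_iff_isUnit]
  convert! b'.linearIndependent using 1
  funext k α
  simp only [Matrix.col_apply, Matrix.of_apply, hx', b', Module.Basis.reindex_apply]

omit [Differential K] [DifferentialAlgebra K L] in
theorem exists_system_of_fundamentalFamily (v : Fin m → MvPowerSeries (Fin m) K) (p : ℕ) :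
    ∃ B : Matrix (VEExponent m p) (VEExponent m p) K,
      (∀ x : VEExponent m p → ℕ → Fin m → L, IsFundamentalFamily v p x →
        (Matrix.of fun α k => veMonomials K p (x k) α).map (fun y => y′) =
          B.map (algebraMap K L) * Matrix.of fun α k => veMonomials K p (x k) α) ∧
      ∀ x : ℕ → Fin m → L, IsVESolution v p x →
        (fun α => (veMonomials K p x α)′) = (B.map (algebraMap K L)).mulVec (veMonomials K p x) := by
  obtain ⟨B, hB⟩ := exists_linearization (L := L) v p
  refine ⟨B, fun x hx => ?_, fun x hx => ?_⟩
  · ext α k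
    simpa [Matrix.mul_apply] using hB (x k) (hx.1 k) α
  · funext α
    simpa [Matrix.mulVec, dotProduct] using hB x hx α

omit [CharZero L] [Differential L] [Differential K] [DifferentialAlgebra K L] in
theorem aeval_veValues_mem (R : Subalgebra K L) {x : ℕ → Fin m → L}
    (hx : ∀ s, 1 ≤ s → s ≤ p → ∀ i, x s i ∈ R) {P : MvPolynomial (ℕ × Fin m) K}
    (hP : ∀ α ∈ P.support, Finsupp.weight (veWeight m) α ≤ p) :
    MvPolynomial.aeval (veValues x) P ∈ R := by
  rw [MvPolynomial.aeval_def, MvPolynomial.eval₂_eq]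
  refine sum_mem fun α hα => mul_mem (R.algebraMap_mem _) (prod_mem fun s hs => pow_mem ?_ _)
  have := (lt_of_mem_support_of_weight hs).trans_le (hP α hα)
  exact hx _ (by omega) (by omega) _

omit [CharZero L] [Differential L] [Differential K] [DifferentialAlgebra K L] in
theorem veMonomials_mem (R : Subalgebra K L) {x : ℕ → Fin m → L}
    (hx : ∀ s, 1 ≤ s → s ≤ p → ∀ i, x s i ∈ R) (α : VEExponent m p) :
    veMonomials K p x α ∈ R := by
  refine aeval_veValues_mem R hx fun β hβ => ?_
  rw [Finset.mem_singleton.1 (MvPolynomial.support_monomial_subset hβ)]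
  exact α.2

omit [CharZero L] [Differential L] [Differential K] [DifferentialAlgebra K L] in
theorem veInhomogeneity_mem (R : Subalgebra K L) {x : ℕ → Fin m → L}
    (hx : ∀ s, 1 ≤ s → s ≤ p → ∀ i, x s i ∈ R) (j : Fin m) :
    veInhomogeneity v p x j ∈ R := by
  refine mul_mem (natCast_mem R _) (aeval_veValues_mem R (p := p + 1) (fun s h1 hs i => ?_)
    fun α => weight_le_of_mem_support_veCoeff)
  rcases Nat.lt_or_eq_of_le hs with h2 | rfl
  · rw [Function.update_of_ne h2.ne]
    exact hx s h1 (by omega) i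
  · rw [Function.update_self]
    exact zero_mem R

end Fundamental

/-! ### Generators of `PVofVE` and the Picard–Vessiot property -/

section Generation

variable {K L : Type*} [Field K] [Field L] [Differential L] [Algebra K L]

theorem subset_differentialAdjoin (S : Set L) : S ⊆ differentialAdjoin K S := by
  intro y hy
  unfold differentialAdjoin
  rw [IntermediateField.coe_sInf]
  simp only [Set.mem_iInter]
  exact fun F hF => hF.2 hy

theorem differentialAdjoin_le {S : Set L} {F : IntermediateField K L} (hF : ∀ x ∈ F, x′ ∈ F)
    (hS : S ⊆ F) : differentialAdjoin K S ≤ F :=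
  sInf_le ⟨hF, hS⟩

variable {m : ℕ} {v : Fin m → MvPowerSeries (Fin m) K} {p : ℕ}

theorem IsVESolution.mem_PVofVE {x : ℕ → Fin m → L} (hx : IsVESolution v p x) {q : ℕ}
    (h1 : 1 ≤ q) (hq : q ≤ p) (i : Fin m) : x q i ∈ PVofVE L v p :=
  subset_differentialAdjoin _ ⟨x, hx, q, h1, hq, i, rfl⟩

theorem PVofVE_le {F : IntermediateField K L} (hF : ∀ x ∈ F, x′ ∈ F)
    (hS : ∀ x : ℕ → Fin m → L, IsVESolution v p x → ∀ q, 1 ≤ q → q ≤ p → ∀ i, x q i ∈ F) :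
    PVofVE L v p ≤ F := by
  refine differentialAdjoin_le hF ?_
  rintro _ ⟨x, hx, q, h1, hq, i, rfl⟩
  exact hS x hx q h1 hq i

theorem deriv_mem_PVofVE {x : L} (hx : x ∈ PVofVE L v p) : x′ ∈ PVofVE L v p :=
  deriv_mem_differentialAdjoin _ hx

theorem HasGeneralVESolution.PVofVE_le_succ [CharZero L] (hv : HasGeneralVESolution L v) :
    PVofVE L v p ≤ PVofVE L v (p + 1) := by
  refine PVofVE_le (fun _ => deriv_mem_PVofVE) fun x hx q h1 hq i => ?_
  obtain ⟨z, hz, hzx⟩ := hv.exists_extend hx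
  rw [← hzx q h1 hq]
  exact hz.mem_PVofVE h1 (by omega) i

theorem HasGeneralVESolution.PVofVE_mono [CharZero L] (hv : HasGeneralVESolution L v) :
    Monotone (PVofVE L v) :=
  monotone_nat_of_le_succ fun _ => hv.PVofVE_le_succ

theorem IsVESolution.veMonomials_mem_PVofVE {x : ℕ → Fin m → L} (hx : IsVESolution v p x)
    (α : VEExponent m p) : veMonomials K p x α ∈ PVofVE L v p :=
  veMonomials_mem (PVofVE L v p).toSubalgebra (fun _ h1 hs i => hx.mem_PVofVE h1 hs i) α

variable [Differential K] [DifferentialAlgebra K L] [CharZero L]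

/-- `PV(VE_p)` is generated by the monomials of a fundamental family of solutions. -/
theorem IsFundamentalFamily.PVofVE_eq (hL : ∀ y : L, y′ = 0 → ∃ a : K, algebraMap K L a = y)
    {x : VEExponent m p → ℕ → Fin m → L} (hx : IsFundamentalFamily v p x) :
    PVofVE L v p =
      IntermediateField.adjoin K {y : L | ∃ α k, y = veMonomials K p (x k) α} := by
  obtain ⟨B, hB, hB'⟩ := exists_system_of_fundamentalFamily (L := L) v p
  refine le_antisymm (PVofVE_le (fun y => deriv_mem_adjoin ?_) fun z hz q h1 hq i => ?_)
    (IntermediateField.adjoin_le_iff.2 ?_)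
  · rintro _ ⟨α, k, rfl⟩
    refine (congrFun (hB' (x k) (hx.1 k)) α).symm ▸ ?_
    exact sum_mem fun β _ => mul_mem (IntermediateField.algebraMap_mem _ _)
      (IntermediateField.subset_adjoin _ _ ⟨β, k, rfl⟩)
  -- The monomial vector of any solution is a combination of the fundamental ones with constant
  -- coefficients, and all constants of `L` lie in `K`.
  · obtain ⟨c, hc⟩ := exists_const_mulVec hL hx.2 (hB x hx) (hB' z hz)
    rw [← veMonomials_componentExponent (K := K) h1 hq i z, hc]
    exact sum_mem fun k _ => mul_mem (IntermediateField.subset_adjoin _ _ ⟨_, k, rfl⟩)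
      (IntermediateField.algebraMap_mem _ _)
  · rintro _ ⟨α, k, rfl⟩
    exact (hx.1 k).veMonomials_mem_PVofVE α

theorem IsFundamentalFamily.isPicardVessiot
    (hL : ∀ y : L, y′ = 0 → ∃ a : K, algebraMap K L a = y)
    {x : VEExponent m p → ℕ → Fin m → L} (hx : IsFundamentalFamily v p x) :
    IsPicardVessiot K (PVofVE L v p) := by
  refine ⟨⟨fun {y} hy => ?_⟩, ?_⟩
  · obtain ⟨a, ha⟩ := hL (y : L) (by rw [← PVofVE_coe_deriv, hy]; rfl)
    exact ⟨a, Subtype.ext ha⟩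
  obtain ⟨B, hB, -⟩ := exists_system_of_fundamentalFamily (L := L) v p
  let e := Fintype.equivFin (VEExponent m p)
  let Y : Matrix (VEExponent m p) (VEExponent m p) (PVofVE L v p) := Matrix.of fun α k =>
    ⟨veMonomials K p (x k) α, (hx.1 k).veMonomials_mem_PVofVE α⟩
  have hY : Y.map (PVofVE L v p).val = Matrix.of fun α k => veMonomials K p (x k) α := rfl
  have hinj : Function.Injective (PVofVE L v p).val := (PVofVE L v p).val.injective
  refine ⟨_, B.reindex e e, Y.reindex e e, ?_, ?_, ?_⟩
  · rw [Matrix.det_reindex_self, isUnit_iff_ne_zero]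
    intro h
    have h2 := congrArg (PVofVE L v p).val h
    rw [AlgHom.map_det, AlgHom.mapMatrix_apply, hY, map_zero] at h2
    exact hx.2.ne_zero h2
  · have h1 : Y.map (fun y => y′) = B.map (algebraMap K _) * Y := by
      refine Matrix.map_injective hinj ?_
      refine (hB x hx).trans ?_
      exact (Matrix.map_mul (L := B.map (algebraMap K _)) (M := Y)
        (f := algebraMap (PVofVE L v p) L)).symm
    have h2 := congrArg (fun M => M.submatrix e.symm e.symm) h1
    simp only [← Matrix.submatrix_mul_equiv _ _ _ e.symm] at h2
    exact h2
  -- Generation is checked inside `L`, where the adjoined field is already identified.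
  · refine IntermediateField.map_injective (PVofVE L v p).val ?_
    rw [IntermediateField.adjoin_map, ← AlgHom.fieldRange_eq_map, IntermediateField.fieldRange_val]
    refine Eq.trans ?_ (hx.PVofVE_eq hL).symm
    congr 1
    ext y
    constructor
    · rintro ⟨_, ⟨i, j, rfl⟩, rfl⟩
      exact ⟨e.symm i, e.symm j, rfl⟩
    · rintro ⟨α, k, rfl⟩
      refine ⟨Y α k, ⟨e α, e k, ?_⟩, rfl⟩
      simp

end Generation

/-! ### Integrals of second level -/

section SecondLevel

variable {K L : Type*} [Field K] [Differential K] [Field L] [CharZero L] [Differential L]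
  [Algebra K L] [DifferentialAlgebra K L] {m : ℕ} {v : Fin m → MvPowerSeries (Fin m) K} {p : ℕ}

omit [DifferentialAlgebra K L] [Differential K] [CharZero L] [Differential L] in
theorem mulVec_mem {ι : Type*} [Fintype ι] (R : Subalgebra K L) {M : Matrix ι ι L} {w : ι → L}
    {i : ι} (hM : ∀ k, M i k ∈ R) (hw : ∀ k, w k ∈ R) : M.mulVec w i ∈ R :=
  R.sum_mem fun k _ => mul_mem (hM k) (hw k)

omit [DifferentialAlgebra K L] [Differential K] in
theorem deriv_veMonomials_mem_span {x : ℕ → Fin m → L} (hx : IsVESolution v p x)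
    (α : VEExponent m p) :
    (veMonomials K p x α)′ ∈ Submodule.span K (Set.range (veMonomials K p x)) := by
  obtain ⟨B, hB⟩ := exists_linearization (L := L) v p
  rw [hB x hx α]
  refine sum_mem fun β _ => ?_
  rw [← Algebra.smul_def]
  exact Submodule.smul_mem _ _ (Submodule.subset_span ⟨β, rfl⟩)

/-- The components of solutions are holonomic. -/
theorem IsVESolution.mem_differentiallyFinite {x : ℕ → Fin m → L} (hx : IsVESolution v p x)
    {q : ℕ} (h1 : 1 ≤ q) (hq : q ≤ p) (i : Fin m) : x q i ∈ differentiallyFinite K L := by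
  rw [← veMonomials_componentExponent (K := K) h1 hq i x]
  exact mem_differentiallyFinite_of_linear_system (deriv_veMonomials_mem_span hx) _

/-- Variation of constants gives integrals of second level. -/
theorem IsVESolution.isSecondLevelIntegral (hle : PVofVE L v p ≤ PVofVE L v (p + 1))
    {X : Matrix (Fin m) (Fin m) L} (hX : IsVEFundamental v X)
    (hXmem : ∀ i j, X i j ∈ PVofVE L v p) {x : ℕ → Fin m → L}
    (hx : IsVESolution v (p + 1) x) (i : Fin m) :
    IsSecondLevelIntegral (PVofVE L v p) (PVofVE L v (p + 1)) (X⁻¹.mulVec (x (p + 1)) i) := by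
  -- The inverse may be computed over the subfield, since `X` has its entries there.
  have hXinv : ∀ i j, X⁻¹ i j ∈ PVofVE L v p := by
    intro i j
    let X₀ : Matrix (Fin m) (Fin m) (PVofVE L v p) := Matrix.of fun i j => ⟨X i j, hXmem i j⟩
    have h0 : X₀.map (algebraMap (PVofVE L v p) L) = X := rfl
    have h1 : X⁻¹ = X₀⁻¹.map (algebraMap (PVofVE L v p) L) := by
      have hdet : IsUnit X₀.det := by
        rw [isUnit_iff_ne_zero]
        intro h
        have h2 := congrArg (algebraMap (PVofVE L v p) L) h
        rw [RingHom.map_det, RingHom.mapMatrix_apply, h0, map_zero] at h2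
        exact hX.1.ne_zero h2
      refine Matrix.inv_eq_right_inv ?_
      rw [← h0, ← Matrix.map_mul, Matrix.mul_nonsing_inv X₀ hdet]
      exact map_one (algebraMap (PVofVE L v p) L).mapMatrix
    rw [h1]
    exact (X₀⁻¹ i j).2
  have hsol := isVESolution_succ_iff.1 hx
  have hder := deriv_inv_mulVec hX.1 hX.2 (y := x (p + 1)) (f := veInhomogeneity v p x) (by
    funext j
    simpa [Matrix.mulVec, dotProduct] using hsol.2 j)
  refine ⟨mulVec_mem (PVofVE L v (p + 1)).toSubalgebra (fun k => hle (hXinv i k))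
    (hx.mem_PVofVE (by omega) le_rfl), ?_⟩
  rw [congrFun hder i]
  refine ⟨mulVec_mem (PVofVE L v p).toSubalgebra (hXinv i)
    (veInhomogeneity_mem _ fun s h1 hs i => hsol.1.mem_PVofVE h1 hs i), ?_⟩
  -- Differentially finite elements form an algebra, so `X⁻¹ f` inherits the property from the
  -- entries of `X⁻¹` and the lower components.
  exact isHolonomic_of_mem_differentiallyFinite (mulVec_mem _
    (inv_entry_mem_differentiallyFinite hX.1 hX.2 i)
    (veInhomogeneity_mem _ fun s h1 hs i => hsol.1.mem_differentiallyFinite h1 hs i))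

theorem HasGeneralVESolution.exists_secondLevelIntegrals (hv : HasGeneralVESolution L v)
    (hC : {c : K | c′ = 0}.Infinite)
    (hL : ∀ y : L, y′ = 0 → ∃ a : K, algebraMap K L a = y) (hp : 1 ≤ p) :
    ∃ S : Set L, S.Finite ∧
      (∀ Φ ∈ S, IsSecondLevelIntegral (PVofVE L v p) (PVofVE L v (p + 1)) Φ) ∧
      PVofVE L v p ⊔ IntermediateField.adjoin K S = PVofVE L v (p + 1) := by
  obtain ⟨X, hX, hXsol⟩ := hv.exists_fundamental
  obtain ⟨x, hx⟩ := hv.exists_fundamentalFamily hC (p + 1)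
  -- Here `1 ≤ p` matters: `X` comes from the first equation.
  have hXmem : ∀ i j, X i j ∈ PVofVE L v p := fun i j =>
    hv.PVofVE_mono hp ((hXsol j).mem_PVofVE le_rfl le_rfl i)
  let S : Set L := Set.range fun s : VEExponent m (p + 1) × Fin m =>
    X⁻¹.mulVec (x s.1 (p + 1)) s.2
  have hS : ∀ Φ ∈ S, IsSecondLevelIntegral (PVofVE L v p) (PVofVE L v (p + 1)) Φ := by
    rintro _ ⟨⟨k, i⟩, rfl⟩
    exact (hx.1 k).isSecondLevelIntegral hv.PVofVE_le_succ hX hXmem i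
  refine ⟨S, Set.finite_range _, hS, le_antisymm (sup_le hv.PVofVE_le_succ
    (IntermediateField.adjoin_le_iff.2 fun y hy => (hS y hy).1)) ?_⟩
  rw [hx.PVofVE_eq hL, IntermediateField.adjoin_le_iff]
  rintro _ ⟨α, k, rfl⟩
  refine veMonomials_mem (PVofVE L v p ⊔ IntermediateField.adjoin K S).toSubalgebra
    (fun s h1 hs i => ?_) α
  rcases Nat.lt_or_eq_of_le hs with h2 | rfl
  · exact (le_sup_left : PVofVE L v p ≤ _)
      (((hx.1 k).mono p.le_succ).mem_PVofVE h1 (by omega) i)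
  -- The top component is recovered from its integrals by multiplying back by `X`.
  · have : x k (p + 1) = X.mulVec (X⁻¹.mulVec (x k (p + 1))) := by
      rw [Matrix.mulVec_mulVec, Matrix.mul_nonsing_inv X hX.1, Matrix.one_mulVec]
    rw [this]
    exact mulVec_mem _ (fun l => (le_sup_left : PVofVE L v p ≤ _) (hXmem i l)) fun l =>
      (le_sup_right : IntermediateField.adjoin K S ≤ _)
        (IntermediateField.subset_adjoin _ _ ⟨(k, l), rfl⟩)

end SecondLevel

/-! ### Virtually solvable extensions -/

section Groups

theorem IsVirtuallyAbelian.isVirtuallySolvable {G : Type*} [Group G] (h : IsVirtuallyAbelian G) :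
    IsVirtuallySolvable G := by
  obtain ⟨H, hH, hcomm⟩ := h
  exact ⟨H, hH, Group.isSolvable_of_comm fun a b => Subtype.ext (hcomm a a.2 b b.2)⟩

/-- The preimage of a solvable subgroup of finite index has finite index and is an extension of a
solvable group by an abelian one. -/
theorem IsVirtuallySolvable.of_ker_comm {G G' : Type*} [Group G] [Group G'] (r : G →* G')
    (hr : ∀ a ∈ r.ker, ∀ b ∈ r.ker, a * b = b * a) (h : IsVirtuallySolvable G') :
    IsVirtuallySolvable G := by
  obtain ⟨H, hH, hs⟩ := h
  refine ⟨H.comap r, ⟨?_⟩, ?_⟩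
  · have := Subgroup.relIndex_comap_ne_zero (J := H) (K := ⊤) r (by
      rw [Subgroup.relIndex_top_right]; exact hH.index_ne_zero)
    rwa [Subgroup.comap_top, Subgroup.relIndex_top_right] at this
  · have hker : Group.IsSolvable (r.subgroupComap H).ker := by
      refine Group.isSolvable_of_comm fun a b => Subtype.ext (Subtype.ext ?_)
      exact hr _ (congrArg Subtype.val a.2) _ (congrArg Subtype.val b.2)
    exact Group.isSolvable_of_ker_le_range (r.subgroupComap H).ker.subtype (r.subgroupComap H)
      (Subgroup.range_subtype _).ge

end Groups

/-! ### Restriction of differential Galois groups and its kernel -/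

section Galois

variable {K L : Type*} [Field K] [Field L] [CharZero L] [Differential L] [Algebra K L]
  {m : ℕ} {v : Fin m → MvPowerSeries (Fin m) K} {p : ℕ}

/-- Differential automorphisms of `PV(VE_{p+1})` preserve `PV(VE_p)`. -/
theorem differentialGal_apply_mem (hle : PVofVE L v p ≤ PVofVE L v (p + 1))
    (σ : differentialGal K (PVofVE L v (p + 1))) {y : L} (hy : y ∈ PVofVE L v p) :
    ((σ.1 ⟨y, hle hy⟩ : PVofVE L v (p + 1)) : L) ∈ PVofVE L v p := by
  let E := PVofVE L v (p + 1)
  let g : E →ₐ[K] L := E.val.comp σ.1.toAlgHom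
  have hg : ∀ a : E, g (a′) = (g a)′ := fun a => congrArg Subtype.val (σ.2 a)
  -- `F` consists of the elements that `σ` sends into `PVofVE L v p`. It is closed under the
  -- derivation and contains all components of solutions, because `σ` permits transport of solutions
  -- to solutions.
  let F : IntermediateField K L := ((PVofVE L v p).comap g).map E.val
  have hF : PVofVE L v p ≤ F := by
    refine PVofVE_le ?_ fun x hx q h1 hq i => ?_
    · rintro _ ⟨z, hz, rfl⟩
      refine ⟨z′, ?_, rfl⟩
      change g (z′) ∈ PVofVE L v p
      rw [hg]
      exact deriv_mem_PVofVE hz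
    · let z : ℕ → Fin m → E := fun s i =>
        if h : 1 ≤ s ∧ s ≤ p then ⟨x s i, hle (hx.mem_PVofVE h.1 h.2 i)⟩ else 0
      have hzx : ∀ s, 1 ≤ s → s ≤ p → ∀ i, ((z s i : E) : L) = x s i := fun s h1 hs i => by
        simp only [z, dif_pos (And.intro h1 hs)]
      have : CharZero E := (algebraMap E L).charZero
      have hz : IsVESolution v p z :=
        (IsVESolution.map_iff E.val fun _ => rfl).1
          (hx.congr fun s h1 hs => funext fun i => (hzx s h1 hs i).symm)
      refine ⟨z q i, ?_, hzx q h1 hq i⟩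
      exact ((IsVESolution.map_iff g hg).2 hz).mem_PVofVE h1 hq i
  obtain ⟨z, hz, hzy⟩ := hF hy
  have : z = ⟨y, hle hy⟩ := Subtype.ext hzy
  exact this ▸ hz

/-- Restriction of a differential automorphism of `PV(VE_{p+1})` to `PV(VE_p)`. -/
noncomputable def differentialGalRestrictHom (hle : PVofVE L v p ≤ PVofVE L v (p + 1))
    (σ : differentialGal K (PVofVE L v (p + 1))) : PVofVE L v p →ₐ[K] PVofVE L v p :=
  ((PVofVE L v (p + 1)).val.comp
    (σ.1.toAlgHom.comp (IntermediateField.inclusion hle))).codRestrict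
      (PVofVE L v p).toSubalgebra fun y => differentialGal_apply_mem hle σ y.2

theorem differentialGalRestrictHom_mul (hle : PVofVE L v p ≤ PVofVE L v (p + 1))
    (σ τ : differentialGal K (PVofVE L v (p + 1))) (y : PVofVE L v p) :
    differentialGalRestrictHom hle (σ * τ) y =
      differentialGalRestrictHom hle σ (differentialGalRestrictHom hle τ y) := rfl

/-- The restriction homomorphism of differential Galois groups. -/
noncomputable def differentialGalRestrict (hle : PVofVE L v p ≤ PVofVE L v (p + 1)) :
    differentialGal K (PVofVE L v (p + 1)) →* differentialGal K (PVofVE L v p) where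
  toFun σ := ⟨AlgEquiv.ofAlgHom (differentialGalRestrictHom hle σ)
      (differentialGalRestrictHom hle σ⁻¹)
      (AlgHom.ext fun y => by
        rw [AlgHom.comp_apply, ← differentialGalRestrictHom_mul, mul_inv_cancel]; rfl)
      (AlgHom.ext fun y => by
        rw [AlgHom.comp_apply, ← differentialGalRestrictHom_mul, inv_mul_cancel]; rfl),
    fun y => Subtype.ext (congrArg (Subtype.val : PVofVE L v (p + 1) → L)
      (σ.2 (IntermediateField.inclusion hle y)))⟩
  map_one' := rfl
  map_mul' _ _ := rfl

theorem differentialGalRestrict_apply (hle : PVofVE L v p ≤ PVofVE L v (p + 1))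
    (σ : differentialGal K (PVofVE L v (p + 1))) (y : PVofVE L v p) :
    (((differentialGalRestrict hle σ).1 y : PVofVE L v p) : L) =
      ((σ.1 (IntermediateField.inclusion hle y) : PVofVE L v (p + 1)) : L) := rfl

/-- If `PV(VE_{p+1})` is generated over `PV(VE_p)` by integrals of elements of `PV(VE_p)`, then the
automorphisms over `PV(VE_p)` commute. -/
theorem differentialGalRestrict_ker_comm (hle : PVofVE L v p ≤ PVofVE L v (p + 1))
    (hL : ∀ y : L, y′ = 0 → ∃ a : K, algebraMap K L a = y) {S : Set L}
    (hS : ∀ Φ ∈ S, IsSecondLevelIntegral (PVofVE L v p) (PVofVE L v (p + 1)) Φ)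
    (hgen : PVofVE L v p ⊔ IntermediateField.adjoin K S = PVofVE L v (p + 1)) :
    ∀ σ ∈ (differentialGalRestrict hle).ker, ∀ τ ∈ (differentialGalRestrict hle).ker,
      σ * τ = τ * σ := by
  let E := PVofVE L v (p + 1)
  have hfix : ∀ σ ∈ (differentialGalRestrict hle).ker, ∀ y (hy : y ∈ PVofVE L v p),
      σ.1 (⟨y, hle hy⟩ : E) = ⟨y, hle hy⟩ := by
    intro σ hσ y hy
    apply Subtype.ext
    have := differentialGalRestrict_apply hle σ ⟨y, hy⟩
    rw [MonoidHom.mem_ker.1 hσ] at this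
    exact this.symm
  -- Since `σ` fixes `Φ′`, the difference `σ Φ - Φ` is a constant, hence in `K`. Translations by
  -- elements of `K` commute.
  have hshift : ∀ σ ∈ (differentialGalRestrict hle).ker, ∀ Φ (hΦ : Φ ∈ S),
      ∃ c : K, σ.1 (⟨Φ, (hS Φ hΦ).1⟩ : E) = ⟨Φ, (hS Φ hΦ).1⟩ + algebraMap K E c := by
    intro σ hσ Φ hΦ
    let Ψ : E := ⟨Φ, (hS Φ hΦ).1⟩
    have h1 : σ.1 (Ψ′) = Ψ′ := hfix σ hσ (Φ′) (hS Φ hΦ).2.1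
    have h2 : (σ.1 Ψ - Ψ)′ = 0 := by rw [map_sub, ← σ.2 Ψ, h1, sub_self]
    obtain ⟨c, hc⟩ := hL ((σ.1 Ψ - Ψ : E) : L) (congrArg Subtype.val h2)
    refine ⟨c, ?_⟩
    have h3 : algebraMap K E c = σ.1 Ψ - Ψ := Subtype.ext hc
    rw [h3, add_sub_cancel]
  intro σ hσ τ hτ
  -- The locus where `σ * τ` and `τ * σ` agree is a field, so it suffices to test generators.
  let F : IntermediateField K E :=
    (AlgHom.equalizer (σ * τ).1.toAlgHom (τ * σ).1.toAlgHom).toIntermediateField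
      fun y hy => by
        change (σ * τ).1 y⁻¹ = (τ * σ).1 y⁻¹
        rw [map_inv₀, map_inv₀]
        exact congrArg _ hy
  have hF : E ≤ F.map E.val := by
    refine hgen.ge.trans (sup_le (fun y hy => ⟨⟨y, hle hy⟩, ?_, rfl⟩)
      (IntermediateField.adjoin_le_iff.2 fun Φ hΦ => ⟨⟨Φ, (hS Φ hΦ).1⟩, ?_, rfl⟩))
    · change σ.1 (τ.1 _) = τ.1 (σ.1 _)
      rw [hfix τ hτ y hy, hfix σ hσ y hy, hfix τ hτ y hy]
    · change σ.1 (τ.1 _) = τ.1 (σ.1 _)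
      obtain ⟨c, hc⟩ := hshift σ hσ Φ hΦ
      obtain ⟨d, hd⟩ := hshift τ hτ Φ hΦ
      rw [hc, hd, map_add, map_add, hc, hd, AlgEquiv.commutes, AlgEquiv.commutes]
      ring
  refine Subtype.ext (AlgEquiv.ext fun y => ?_)
  obtain ⟨z, hz, hzy⟩ := hF y.2
  have : z = y := Subtype.ext hzy
  exact this ▸ hz

end Galois

/-! ### Assembly -/

theorem lemma2p1 {K L : Type*} [Field K] [Differential K] [Algebra ℂ K]
    [Field L] [Differential L] [Algebra K L] [DifferentialAlgebra K L]
    (hK : ∀ a : K, a′ = 0 ↔ ∃ c : ℂ, algebraMap ℂ K c = a)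
    (hL : ∀ y : L, y′ = 0 → ∃ a : K, algebraMap K L a = y)
    {m : ℕ} (v : Fin m → MvPowerSeries (Fin m) K)
    (hv : HasGeneralVESolution L v)
    (hG : IsVirtuallyAbelian (differentialGal K (PVofVE L v 1))) :
    ∀ p : ℕ, 1 ≤ p →
      (PVofVE L v p ≤ PVofVE L v (p + 1) ∧
        ∃ S : Set L, S.Finite ∧
          (∀ Φ ∈ S, IsSecondLevelIntegral (PVofVE L v p) (PVofVE L v (p + 1)) Φ) ∧
          PVofVE L v p ⊔ IntermediateField.adjoin K S = PVofVE L v (p + 1)) ∧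
      (IsPicardVessiot K (PVofVE L v p) ∧
        IsVirtuallySolvable (differentialGal K (PVofVE L v p))) := by
  have hK0 : CharZero K := charZero_of_injective_algebraMap (algebraMap ℂ K).injective
  have hL0 : CharZero L := charZero_of_injective_algebraMap (algebraMap K L).injective
  -- The density argument needs infinitely many constants; the copy of `ℂ` in `K` provides them.
  have hC : {c : K | c′ = 0}.Infinite :=
    (Set.infinite_range_of_injective (algebraMap ℂ K).injective).mono fun c hc => (hK c).2 hc
  intro p hp
  refine ⟨⟨hv.PVofVE_le_succ, hv.exists_secondLevelIntegrals hC hL hp⟩, ?_, ?_⟩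
  · obtain ⟨x, hx⟩ := hv.exists_fundamentalFamily hC p
    exact hx.isPicardVessiot hL
  · induction p, hp using Nat.le_induction with
    | base => exact hG.isVirtuallySolvable
    | succ p hp ih =>
      obtain ⟨S, -, hS, hgen⟩ := hv.exists_secondLevelIntegrals hC hL hp
      exact IsVirtuallySolvable.of_ker_comm (differentialGalRestrict hv.PVofVE_le_succ)
        (differentialGalRestrict_ker_comm hv.PVofVE_le_succ hL hS hgen) ih
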